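/- Let $\mathbb T^\star\subseteq\mathbb R$ be a time scale (nonempty closed set), let $s_0\in\mathbb T^\star$, and for $s_1\in\mathbb T^\star$ put $J_{s_1}=(-\infty,s_1]\cap\mathbb T^\star$, regarded as a time scale, with backward and forward jump operators $\hat\rho$, $\hat\sigma$ ($\hat\rho(\min)=\min$, $\hat\sigma(\max)=\max$) and nabla derivative $\hat\nabla$. A function on a time scale is ld-continuous if it is continuous at the points with $\hat\rho(s)=s$ and has a finite right limit at the points with $\hat\sigma(s)=s$. Let $q,r\ge 0$ be integers. A backward system of dimension $n$ is $y^{\hat\nabla}(s)=\bar A(s)y(s)+\bar B(s)v(s)$, $\gamma(s)=\bar C(s)y(s)$, $s\in J_{s_0}$, with ld-continuous $\bar A:J_{s_0}\to\mathbb R^{n\times n}$, $\bar B:J_{s_0}\to\mathbb R^{n\times r}$, $\bar C:J_{s_0}\to\mathbb R^{q\times n}$. Its transition function is the matrix function $\Psi_{\bar A}(s,w)$, $s,w\in J_{s_0}$, such that for every $w\in J_{s_0}$ one has $\Psi_{\bar A}(w,w)=I$ and $\Psi_{\bar A}(\cdot,w)^{\hat\nabla}(s)=\bar A(s)\Psi_{\bar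 A}(s,w)$ for every $s\in (J_{s_0})_\kappa$ (that is, $J_{s_0}$ without its minimum if this is right-scattered). (It exists on all pairs $(s,w)$ exactly when the system is progressive, i.e. $I-\hat\nu(s)\bar A(s)$ is invertible for all $s\in (J_{s_0})_\kappa$, where $\hat\nu(s)=s-\hat\rho(s)$.) A function $\bar G:J_{s_0}\times J_{s_0}\to\mathbb R^{q\times r}$ is realizable (with dimension $n$) if it is the weighting pattern of such a system, i.e. there is a backward system (of dimension $n$) that has a transition function on $J_{s_0}\times J_{s_0}$ and satisfies $$\bar G(s,z)=\bar C(s)\,\Psi_{\bar A}(s,\hat\rho(z))\,\bar B(z)\qquad\text{for all } s,z\in J_{s_0}.$$ **Theorem 6.1.** Let $\bar G:J_{s_0}\times J_{s_0}\to\mathbb R^{q\times r}$. Then $\bar G$ is realizable if and only if for each $s_1\in\mathbb T^\star$ with $s_1\le s_0$ there exist an integer $n\ge 0$ and ld-continuous matrix functions $\bar H:J_{s_1}\to\mathbb R^{q\times n}$ and $\bar F:J_{s_1}\to\mathbb R^{n\times r}$ such that $$\bar G(s,z)=\bar H(s)\bar F(z)\qquad\text{for all } s,z\in J_{s_1}.$$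 Moreover, the equivalence holds for every fixed $n$: $\bar G$ is realizable with dimension $n$ if and only if for each $s_1\in\mathbb T^\star$ with $s_1\le s_0$ such $\bar H$ and $\bar F$ exist with this $n$. -/

import Mathlib

open Set Filter Topology

noncomputable section

namespace TimeScale

/-- A time scale: a nonempty closed subset of the real line. -/
def IsTimeScale (X : Set ℝ) : Prop := X.Nonempty ∧ IsClosed X

/-- The backward jump operator `ρ` of `X`: the supremum of the points of `X` below `s`, and `s`
itself if there is none (so `ρ (min X) = min X`). -/
def rho (X : Set ℝ) (s : ℝ) : ℝ :=
  open Classical in if (X ∩ Iio s).Nonempty then sSup (X ∩ Iio s) else s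

/-- The forward jump operator `σ` of `X`: the infimum of the points of `X` above `s`, and `s`
itself if there is none (so `σ (max X) = max X`). -/
def sigma (X : Set ℝ) (s : ℝ) : ℝ :=
  open Classical in if (X ∩ Ioi s).Nonempty then sInf (X ∩ Ioi s) else s

/-- The set `X_κ`: the time scale `X` without its minimum, if `X` has a minimum and this minimum
is right-scattered; otherwise `X`. -/
def kappa (X : Set ℝ) : Set ℝ := {s | s ∈ X ∧ ¬ (IsLeast X s ∧ s < sigma X s)}

/-- The part `(-∞, s₁]_X` of the time scale `X`. It is the time scale on which the functions of a
backward system live; for its points `s` the backward jump is the same in `X` and in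
`(-∞, s₁]_X`. -/
def leftRay (X : Set ℝ) (s₁ : ℝ) : Set ℝ := X ∩ Iic s₁

/-- `f` is ld-continuous on the time scale `X`: it is continuous at the left-dense points
(`ρ s = s`) of `X` and has a (finite) limit from the right at the right-dense points (`σ s = s`). -/
def LdContinuous {E : Type*} [TopologicalSpace E] (X : Set ℝ) (f : ℝ → E) : Prop :=
  ∀ s ∈ X, (rho X s = s → ContinuousWithinAt f X s) ∧
    (sigma X s = s → ∃ L : E, Tendsto f (𝓝[X ∩ Ioi s] s) (𝓝 L))

/-- The real function `f` on the time scale `X` has nabla derivative `d` at the point `s`. -/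
def HasNablaDeriv (X : Set ℝ) (f : ℝ → ℝ) (d : ℝ) (s : ℝ) : Prop :=
  ∀ ε > 0, ∃ δ > 0, ∀ w ∈ X, |w - s| < δ →
    |f (rho X s) - f w - d * (rho X s - w)| ≤ ε * |rho X s - w|

/-- Nabla derivative of a matrix function (entry by entry). -/
def HasMatrixNablaDeriv {m n : ℕ} (X : Set ℝ) (M : ℝ → Matrix (Fin m) (Fin n) ℝ)
    (D : Matrix (Fin m) (Fin n) ℝ) (s : ℝ) : Prop :=
  ∀ i j, HasNablaDeriv X (fun w => M w i j) (D i j) s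

/-- `Ψ` is the transition function of `y^∇(s) = A(s) y(s)` on the time scale `X`: for every
`w ∈ X`, the function `s ↦ Ψ(s, w)` is the solution on `X` with `Ψ(w, w) = I`. Here `(s, w)` ranges
over all pairs of points of `X`, so at a left-scattered `s` the matrix `I - ν(s) A(s)`, which
satisfies `Ψ(ρ(s), w) = (I - ν(s) A(s)) Ψ(s, w)`, is invertible (take `w = ρ(s)`). -/
def IsTransition {n : ℕ} (X : Set ℝ) (A : ℝ → Matrix (Fin n) (Fin n) ℝ)
    (Ψ : ℝ → ℝ → Matrix (Fin n) (Fin n) ℝ) : Prop :=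
  ∀ w ∈ X, Ψ w w = 1 ∧
    ∀ s ∈ kappa X, HasMatrixNablaDeriv X (fun t => Ψ t w) (A s * Ψ s w) s

/-- The backward system `y^∇ = A y + B v`, `γ = C y` on the time scale `X`, with ld-continuous
coefficients, `n`-dimensional state, `r`-dimensional control and `q`-dimensional output. -/
structure BackwardSystem (X : Set ℝ) (q n r : ℕ) where
  A : ℝ → Matrix (Fin n) (Fin n) ℝ
  B : ℝ → Matrix (Fin n) (Fin r) ℝ
  C : ℝ → Matrix (Fin q) (Fin n) ℝ
  ld_A : LdContinuous X A
  ld_B : LdContinuous X B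
  ld_C : LdContinuous X C

/-- `Λ` is a realization of `G`: `G(s, z) = C(s) Ψ_A(s, ρ(z)) B(z)` for all `s, z ∈ X`, where `Ψ_A`
is the transition function of `Λ`. -/
def BackwardSystem.IsRealization {X : Set ℝ} {q n r : ℕ} (Λ : BackwardSystem X q n r)
    (G : ℝ → ℝ → Matrix (Fin q) (Fin r) ℝ) : Prop :=
  ∃ Ψ : ℝ → ℝ → Matrix (Fin n) (Fin n) ℝ, IsTransition X Λ.A Ψ ∧
    ∀ s ∈ X, ∀ z ∈ X, G s z = Λ.C s * Ψ s (rho X z) * Λ.B z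

/-- `G` has a realization with `n`-dimensional state on the time scale `X`. -/
def IsRealizableOfDim (X : Set ℝ) {q r : ℕ} (n : ℕ)
    (G : ℝ → ℝ → Matrix (Fin q) (Fin r) ℝ) : Prop :=
  ∃ Λ : BackwardSystem X q n r, Λ.IsRealization G

/-- `G` is the weighting pattern of some backward system on the time scale `X`. -/
def IsRealizable (X : Set ℝ) {q r : ℕ} (G : ℝ → ℝ → Matrix (Fin q) (Fin r) ℝ) : Prop :=
  ∃ n : ℕ, IsRealizableOfDim X n G

/-- `G(s, z) = H(s) F(z)` for `s, z ∈ X`, where `H` and `F` are ld-continuous on `X`, with values in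
the `q × n` and the `n × r` matrices. -/
def Factors (X : Set ℝ) {q r : ℕ} (n : ℕ) (G : ℝ → ℝ → Matrix (Fin q) (Fin r) ℝ) : Prop :=
  ∃ (H : ℝ → Matrix (Fin q) (Fin n) ℝ) (F : ℝ → Matrix (Fin n) (Fin r) ℝ),
    LdContinuous X H ∧ LdContinuous X F ∧ ∀ s ∈ X, ∀ z ∈ X, G s z = H s * F z

end TimeScale

end

/-! Since `s₀` is the maximum of the ray, the transition function splits through it: `Ψ(s, w) = Ψ(s,
s₀) Ψ(s₀, w)`. Both sides solve the same equation in `s` and agree at `s₀`, so this needs only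
uniqueness to the left (`eq_zero_of_hasMatrixNablaDeriv`), a Gronwall bound proved by downward
induction without integrals. A realization thus gives `H(s) = C(s) Ψ(s, s₀)` and `F(z) = Ψ(s₀, ρ(z))
B(z)`. Here `Ψ(s₀, ·)` is continuous as the inverse of `Ψ(·, s₀)`, and composing with `ρ` leaves it
ld-continuous. Restriction handles smaller rays.

Conversely, the factorization on the ray of `s₀` itself suffices: `A = 0` has transition function
`I`, and one takes `B = F`, `C = H`. -/

namespace TimeScale

/-! ### Jump operators and downward induction -/

section JumpOperators

variable {X : Set ℝ}

lemma bddAbove_inter_Iio (X : Set ℝ) (s : ℝ) : BddAbove (X ∩ Iio s) :=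
  ⟨s, fun _ hx => le_of_lt hx.2⟩

lemma bddBelow_inter_Ioi (X : Set ℝ) (s : ℝ) : BddBelow (X ∩ Ioi s) :=
  ⟨s, fun _ hx => le_of_lt hx.2⟩

lemma rho_eq_sSup {s : ℝ} (h : (X ∩ Iio s).Nonempty) : rho X s = sSup (X ∩ Iio s) := by
  rw [rho, if_pos h]

lemma sigma_eq_sInf {s : ℝ} (h : (X ∩ Ioi s).Nonempty) : sigma X s = sInf (X ∩ Ioi s) := by
  rw [sigma, if_pos h]

lemma rho_le (X : Set ℝ) (s : ℝ) : rho X s ≤ s := by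
  by_cases h : (X ∩ Iio s).Nonempty
  · rw [rho_eq_sSup h]
    exact csSup_le h fun x hx => le_of_lt hx.2
  · rw [rho, if_neg h]

lemma le_rho {x s : ℝ} (hx : x ∈ X) (hxs : x < s) : x ≤ rho X s := by
  rw [rho_eq_sSup ⟨x, hx, hxs⟩]
  exact le_csSup (bddAbove_inter_Iio X s) ⟨hx, hxs⟩

lemma le_sigma (X : Set ℝ) (s : ℝ) : s ≤ sigma X s := by
  by_cases h : (X ∩ Ioi s).Nonempty
  · rw [sigma_eq_sInf h]
    exact le_csInf h fun x hx => le_of_lt hx.2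
  · rw [sigma, if_neg h]

lemma sigma_le {x s : ℝ} (hx : x ∈ X) (hxs : s < x) : sigma X s ≤ x := by
  rw [sigma_eq_sInf ⟨x, hx, hxs⟩]
  exact csInf_le (bddBelow_inter_Ioi X s) ⟨hx, hxs⟩

lemma rho_mem (hX : IsClosed X) {s : ℝ} (hs : s ∈ X) : rho X s ∈ X := by
  by_cases h : (X ∩ Iio s).Nonempty
  · rw [rho_eq_sSup h]
    exact hX.closure_subset_iff.2 inter_subset_left
      (csSup_mem_closure h (bddAbove_inter_Iio X s))
  · rwa [rho, if_neg h]

lemma nonempty_of_rho_lt {s : ℝ} (h : rho X s < s) : (X ∩ Iio s).Nonempty := by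
  by_contra h'
  rw [rho, if_neg h'] at h
  exact lt_irrefl _ h

lemma mem_kappa_of_nonempty {s : ℝ} (hs : s ∈ X) (h : (X ∩ Iio s).Nonempty) : s ∈ kappa X := by
  obtain ⟨x, hx, hxs⟩ := h
  exact ⟨hs, fun hl => absurd (hl.1.2 hx) (not_le.2 hxs)⟩

/-- Downward induction on a closed set of reals. -/
lemma backward_induction (hX : IsClosed X) {b : ℝ} (P : ℝ → Prop) (hb : P b) (a : ℝ)
    (hgap : ∀ s ∈ X, a ≤ s → s ≤ b → rho X s < s → P s → P (rho X s))
    (hleft : ∀ s ∈ X, a ≤ s → s ≤ b → (X ∩ Iio s).Nonempty → rho X s = s → P s →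
      ∀ᶠ w in 𝓝[X ∩ Iio s] s, P w)
    (hright : ∀ s ∈ X, a ≤ s → s < b → s ∈ closure (X ∩ Ioi s) →
      (∀ t ∈ X, s < t → t ≤ b → P t) → P s) :
    ∀ s ∈ X, a ≤ s → s ≤ b → b ∈ X → P s := by
  intro s hs has hsb hbX
  by_contra hPs
  set D : Set ℝ := {t | t ∈ X ∧ a ≤ t ∧ t ≤ b ∧ ¬ P t} with hD
  have hne : D.Nonempty := ⟨s, hs, has, hsb, hPs⟩
  have hbdd : BddAbove D := ⟨b, fun t ht => ht.2.2.1⟩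
  set c := sSup D with hc
  have hcD : c ∈ closure D := csSup_mem_closure hne hbdd
  have hcX : c ∈ X := hX.closure_subset_iff.2 (fun t ht => ht.1) hcD
  have hac : a ≤ c := has.trans (le_csSup hbdd ⟨hs, has, hsb, hPs⟩)
  have hcb : c ≤ b := csSup_le hne fun t ht => ht.2.2.1
  have hup : ∀ t ∈ X, c < t → t ≤ b → P t := by
    intro t ht hct htb
    by_contra hPt
    exact absurd (le_csSup hbdd ⟨ht, hac.trans hct.le, htb, hPt⟩) (not_le.2 hct)
  -- If `P c` holds, failures accumulate at `c` from the left, against `hleft`. If not, `c` is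
  -- either a limit from the right or `ρ` of a next point.
  by_cases hPc : P c
  · have hlt : ∀ t ∈ D, t < c := fun t ht =>
      lt_of_le_of_ne (le_csSup hbdd ht) fun h => ht.2.2.2 (h ▸ hPc)
    have hsub : D ⊆ X ∩ Iio c := fun t ht => ⟨ht.1, hlt t ht⟩
    have hrho : rho X c = c := by
      refine le_antisymm (rho_le X c) (csSup_le hne fun t ht => le_rho ht.1 (hlt t ht))
    have hev := hleft c hcX hac hcb (hne.mono hsub) hrho hPc
    have := mem_closure_iff_nhdsWithin_neBot.1 hcD
    have hev' : ∀ᶠ w in 𝓝[D] c, P w := hev.filter_mono (nhdsWithin_mono _ hsub)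
    obtain ⟨t, hPt, htD⟩ := (hev'.and self_mem_nhdsWithin).exists
    exact htD.2.2.2 hPt
  · have hcb' : c < b := lt_of_le_of_ne hcb fun h => hPc (h ▸ hb)
    by_cases hcl : c ∈ closure (X ∩ Ioi c)
    · exact hPc (hright c hcX hac hcb' hcl hup)
    · have hn : (X ∩ Ioi c).Nonempty := ⟨b, hbX, hcb'⟩
      have hmem := csInf_mem_closure hn (bddBelow_inter_Ioi X c)
      set d := sInf (X ∩ Ioi c) with hd
      have hdX : d ∈ X := hX.closure_subset_iff.2 inter_subset_left hmem
      have hcd : c < d := lt_of_le_of_ne (le_csInf hn fun t ht => le_of_lt ht.2)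
        fun h => hcl (h ▸ hmem)
      have hdb : d ≤ b := csInf_le (bddBelow_inter_Ioi X c) ⟨hbX, hcb'⟩
      have hrho : rho X d = c := by
        refine le_antisymm ?_ (le_rho hcX hcd)
        rw [rho_eq_sSup ⟨c, hcX, hcd⟩]
        refine csSup_le ⟨c, hcX, hcd⟩ fun t ht => ?_
        by_contra h
        exact absurd (csInf_le (bddBelow_inter_Ioi X c) ⟨ht.1, not_le.1 h⟩) (not_le.2 ht.2)
      have := hgap d hdX (hac.trans hcd.le) hdb (hrho ▸ hcd) (hup d hdX hcd hdb)
      exact hPc (hrho ▸ this)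

lemma exists_between_of_rho_eq {s l : ℝ} (h : rho X s = s) (hne : (X ∩ Iio s).Nonempty)
    (hl : l < s) : ∃ x ∈ X, l < x ∧ x < s := by
  rw [rho_eq_sSup hne] at h
  obtain ⟨x, hx, hlx⟩ := exists_lt_of_lt_csSup hne (h.symm ▸ hl)
  exact ⟨x, hx.1, hlx, hx.2⟩

lemma tendsto_rho_right (hX : IsClosed X) {s : ℝ} (hs : s ∈ X) :
    Tendsto (rho X) (𝓝[X ∩ Ioi s] s) (𝓝[X] s) := by
  refine tendsto_nhdsWithin_iff.2 ⟨?_, ?_⟩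
  · refine tendsto_of_tendsto_of_tendsto_of_le_of_le' tendsto_const_nhds
      (tendsto_id.mono_left nhdsWithin_le_nhds) ?_ (Eventually.of_forall (rho_le X))
    filter_upwards [self_mem_nhdsWithin] with z hz using le_rho hs hz.2
  · filter_upwards [self_mem_nhdsWithin] with z hz using rho_mem hX hz.1

lemma tendsto_rho_of_left_dense (hX : IsClosed X) {s : ℝ} (hs : s ∈ X) (h : rho X s = s) :
    Tendsto (rho X) (𝓝[X] s) (𝓝[X] s) := by
  refine tendsto_nhdsWithin_iff.2 ⟨?_, ?_⟩
  · refine tendsto_order.2 ⟨fun l hl => ?_, fun u hu => ?_⟩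
    · by_cases hne : (X ∩ Iio s).Nonempty
      · obtain ⟨x, hx, hlx, hxs⟩ := exists_between_of_rho_eq h hne hl
        filter_upwards [mem_nhdsWithin_of_mem_nhds (lt_mem_nhds hxs)] with z hz
        exact hlx.trans_le (le_rho hx hz)
      -- The minimum also satisfies `ρ s = s`, though no points approach it from the left.
      · filter_upwards [self_mem_nhdsWithin] with z hz
        rcases lt_trichotomy z s with hzs | rfl | hzs
        · exact absurd ⟨z, hz, hzs⟩ hne
        · rwa [h]
        · exact hl.trans_le (le_rho hs hzs)
    · filter_upwards [mem_nhdsWithin_of_mem_nhds (gt_mem_nhds hu)] with z hz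
      exact (rho_le X z).trans_lt hz
  · filter_upwards [self_mem_nhdsWithin] with z hz using rho_mem hX hz

end JumpOperators

/-! ### Ld-continuity and local boundedness -/

section LdContinuous

variable {X : Set ℝ}

lemma LdContinuous.of_continuousOn {E : Type*} [TopologicalSpace E] {f : ℝ → E}
    (hf : ContinuousOn f X) : LdContinuous X f := fun s hs =>
  ⟨fun _ => hf s hs, fun _ => ⟨f s, (hf s hs).mono_left (nhdsWithin_mono _ inter_subset_left)⟩⟩

/-- Near a left-dense point, and to the right of any point `s`, `ρ z` tends to `s`, so continuity of
`f` gives the limits. -/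
lemma LdContinuous.comp_rho {E : Type*} [TopologicalSpace E] (hX : IsClosed X) {f : ℝ → E}
    (hf : ContinuousOn f X) : LdContinuous X (fun z => f (rho X z)) := by
  intro s hs
  refine ⟨fun h => ?_, fun _ => ⟨f s, (hf s hs).tendsto.comp (tendsto_rho_right hX hs)⟩⟩
  have := (hf s hs).tendsto.comp (tendsto_rho_of_left_dense hX hs h)
  simpa only [ContinuousWithinAt, h, Function.comp_def] using this

lemma tendsto_matrix_mul {ι : Type*} {l : Filter ι} {m n p : ℕ}
    {M : ι → Matrix (Fin m) (Fin n) ℝ} {N : ι → Matrix (Fin n) (Fin p) ℝ}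
    {M₀ : Matrix (Fin m) (Fin n) ℝ} {N₀ : Matrix (Fin n) (Fin p) ℝ}
    (hM : Tendsto M l (𝓝 M₀)) (hN : Tendsto N l (𝓝 N₀)) :
    Tendsto (fun t => M t * N t) l (𝓝 (M₀ * N₀)) := by
  have hc : Continuous fun x : Matrix (Fin m) (Fin n) ℝ × Matrix (Fin n) (Fin p) ℝ =>
    x.1 * x.2 := continuous_fst.matrix_mul continuous_snd
  exact (hc.tendsto (M₀, N₀)).comp (hM.prodMk_nhds hN)

lemma LdContinuous.matrix_mul {m n p : ℕ} {M : ℝ → Matrix (Fin m) (Fin n) ℝ}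
    {N : ℝ → Matrix (Fin n) (Fin p) ℝ} (hM : LdContinuous X M) (hN : LdContinuous X N) :
    LdContinuous X (fun t => M t * N t) := by
  intro s hs
  refine ⟨fun h => tendsto_matrix_mul ((hM s hs).1 h) ((hN s hs).1 h), fun h => ?_⟩
  obtain ⟨L, hL⟩ := (hM s hs).2 h
  obtain ⟨L', hL'⟩ := (hN s hs).2 h
  exact ⟨L * L', tendsto_matrix_mul hL hL'⟩

lemma LdContinuous.mono_leftRay {E : Type*} [TopologicalSpace E] {T : Set ℝ} {s₀ s₁ : ℝ}
    (hs₁ : s₁ ∈ T) (h : s₁ ≤ s₀) {f : ℝ → E} (hf : LdContinuous (leftRay T s₀) f) :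
    LdContinuous (leftRay T s₁) f := by
  have hsub : leftRay T s₁ ⊆ leftRay T s₀ := fun t ht => ⟨ht.1, le_trans ht.2 h⟩
  intro s hs
  refine ⟨fun hr => ((hf s (hsub hs)).1 ?_).mono hsub, fun hr => ?_⟩
  · have hset : leftRay T s₀ ∩ Iio s = leftRay T s₁ ∩ Iio s := by
      ext t
      exact ⟨fun ht => ⟨⟨ht.1.1, le_trans (le_of_lt (show t < s from ht.2)) (show s ≤ s₁ from hs.2)⟩, ht.2⟩,
        fun ht => ⟨hsub ht.1, ht.2⟩⟩
    rwa [rho, hset]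
  · rcases eq_or_lt_of_le (show s ≤ s₁ from hs.2) with rfl | hlt
    -- The new maximum has `σ s = s` by convention; no points lie to its right, so any limit serves.
    · refine ⟨f s, ?_⟩
      have : leftRay T s ∩ Ioi s = ∅ := by
        ext t
        simp only [leftRay, mem_inter_iff, mem_Iic, mem_Ioi, mem_empty_iff_false, iff_false]
        exact fun ht => absurd ht.1.2 (not_le.2 ht.2)
      rw [this, nhdsWithin_empty]
      exact tendsto_bot
    · have hn : (leftRay T s₁ ∩ Ioi s).Nonempty := ⟨s₁, ⟨hs₁, le_refl s₁⟩, hlt⟩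
      have hsub' := inter_subset_inter_left (Ioi s) hsub
      obtain ⟨L, hL⟩ := (hf s (hsub hs)).2 <| by
        refine le_antisymm ?_ (le_sigma _ _)
        conv_rhs => rw [← hr]
        rw [sigma_eq_sInf hn, sigma_eq_sInf (hn.mono hsub')]
        exact csInf_le_csInf (bddBelow_inter_Ioi _ _) hn hsub'
      exact ⟨L, hL.mono_left (nhdsWithin_mono _ hsub')⟩

lemma Factors.mono_leftRay {T : Set ℝ} {s₀ s₁ : ℝ} (hs₁ : s₁ ∈ T) (h : s₁ ≤ s₀) {q r n : ℕ}
    {G : ℝ → ℝ → Matrix (Fin q) (Fin r) ℝ} (hG : Factors (leftRay T s₀) n G) :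
    Factors (leftRay T s₁) n G := by
  obtain ⟨H, F, hH, hF, hGHF⟩ := hG
  have hsub : leftRay T s₁ ⊆ leftRay T s₀ := fun t ht => ⟨ht.1, le_trans ht.2 h⟩
  exact ⟨H, F, hH.mono_leftRay hs₁ h, hF.mono_leftRay hs₁ h,
    fun s hs z hz => hGHF s (hsub hs) z (hsub hz)⟩

/-- An ld-continuous real function is locally bounded. -/
lemma LdContinuous.eventually_abs_le {f : ℝ → ℝ} (hf : LdContinuous X f) {s : ℝ} (hs : s ∈ X) :
    ∃ K, ∀ᶠ t in 𝓝[X] s, |f t| ≤ K := by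
  have hbdd : ∀ {l : Filter ℝ} {L : ℝ}, Tendsto f l (𝓝 L) → ∀ᶠ t in l, |f t| ≤ |L| + 1 :=
    fun h => (h.abs.eventually_lt_const (lt_add_one _)).mono fun _ => le_of_lt
  rcases eq_or_lt_of_le (rho_le X s) with h | h
  · exact ⟨_, hbdd ((hf s hs).1 h)⟩
  · have hr : ∃ K, ∀ᶠ t in 𝓝[X ∩ Ioi s] s, |f t| ≤ K := by
      rcases eq_or_lt_of_le (le_sigma X s) with h' | h'
      · obtain ⟨L, hL⟩ := (hf s hs).2 h'.symm
        exact ⟨_, hbdd hL⟩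
      · refine ⟨0, ?_⟩
        filter_upwards [self_mem_nhdsWithin, mem_nhdsWithin_of_mem_nhds (gt_mem_nhds h')]
          with t ht ht'
        exact absurd (sigma_le ht.1 ht.2) (not_le.2 ht')
    obtain ⟨K, hK⟩ := hr
    -- At a left-scattered point only `s` and the points to its right matter.
    refine ⟨max K |f s|, ?_⟩
    rw [eventually_nhdsWithin_iff] at hK ⊢
    filter_upwards [hK, lt_mem_nhds h] with t ht hρ htX
    rcases lt_trichotomy t s with hts | rfl | hts
    · exact absurd (le_rho htX hts) (not_le.2 hρ)
    · exact le_max_right _ _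
    · exact (ht ⟨htX, hts⟩).trans (le_max_left _ _)

lemma LdContinuous.exists_abs_le {f : ℝ → ℝ} (hf : LdContinuous X f) {S : Set ℝ}
    (hS : IsCompact S) (hSX : S ⊆ X) : ∃ K, ∀ t ∈ S, |f t| ≤ K := by
  refine hS.induction_on (p := fun S => ∃ K, ∀ t ∈ S, |f t| ≤ K) ⟨0, by simp⟩ ?_ ?_ ?_
  · rintro s t hst ⟨K, hK⟩
    exact ⟨K, fun x hx => hK x (hst hx)⟩
  · rintro s t ⟨K, hK⟩ ⟨K', hK'⟩
    refine ⟨max K K', ?_⟩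
    rintro x (hx | hx)
    · exact (hK x hx).trans (le_max_left _ _)
    · exact (hK' x hx).trans (le_max_right _ _)
  · intro x hx
    obtain ⟨K, hK⟩ := hf.eventually_abs_le (hSX hx)
    exact ⟨_, nhdsWithin_mono x hSX hK, K, fun t ht => ht⟩

lemma LdContinuous.matrix_apply {m n : ℕ} {M : ℝ → Matrix (Fin m) (Fin n) ℝ}
    (hM : LdContinuous X M) (i : Fin m) (j : Fin n) : LdContinuous X fun t => M t i j := by
  have hc : Continuous fun N : Matrix (Fin m) (Fin n) ℝ => N i j := continuous_id.matrix_elem i j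
  intro s hs
  refine ⟨fun h => (hc.tendsto _).comp ((hM s hs).1 h), fun h => ?_⟩
  obtain ⟨L, hL⟩ := (hM s hs).2 h
  exact ⟨L i j, (hc.tendsto _).comp hL⟩

lemma LdContinuous.exists_matrix_bound {m n : ℕ} {M : ℝ → Matrix (Fin m) (Fin n) ℝ}
    (hM : LdContinuous X M) {S : Set ℝ} (hS : IsCompact S) (hSX : S ⊆ X) :
    ∃ K, 0 ≤ K ∧ ∀ t ∈ S, ∀ i j, |M t i j| ≤ K := by
  choose K hK using fun i j => (hM.matrix_apply i j).exists_abs_le hS hSX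
  refine ⟨∑ i, ∑ j, |K i j|, by positivity, fun t ht i j => ?_⟩
  calc |M t i j| ≤ |K i j| := (hK i j t ht).trans (le_abs_self _)
    _ ≤ ∑ j, |K i j| :=
      Finset.single_le_sum (f := fun j => |K i j|) (fun _ _ => abs_nonneg _) (Finset.mem_univ j)
    _ ≤ ∑ i, ∑ j, |K i j| :=
      Finset.single_le_sum (f := fun i => ∑ j, |K i j|)
        (fun _ _ => Finset.sum_nonneg fun _ _ => abs_nonneg _) (Finset.mem_univ i)

end LdContinuous

/-! ### Nabla derivatives, Gronwall estimate and uniqueness -/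

section NablaDeriv

variable {X : Set ℝ}

lemma hasNablaDeriv_const (X : Set ℝ) (c s : ℝ) : HasNablaDeriv X (fun _ => c) 0 s := by
  intro ε hε
  refine ⟨1, one_pos, fun w _ _ => ?_⟩
  simp only [sub_self, zero_mul, abs_zero]
  positivity

lemma HasNablaDeriv.sub {f g : ℝ → ℝ} {d e s : ℝ} (hf : HasNablaDeriv X f d s)
    (hg : HasNablaDeriv X g e s) : HasNablaDeriv X (fun t => f t - g t) (d - e) s := by
  intro ε hε
  obtain ⟨δ, hδ, h⟩ := hf (ε / 2) (half_pos hε)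
  obtain ⟨δ', hδ', h'⟩ := hg (ε / 2) (half_pos hε)
  refine ⟨min δ δ', lt_min hδ hδ', fun w hw hws => ?_⟩
  have h1 := h w hw (hws.trans_le (min_le_left _ _))
  have h2 := h' w hw (hws.trans_le (min_le_right _ _))
  have h3 := abs_sub (f (rho X s) - f w - d * (rho X s - w)) (g (rho X s) - g w - e * (rho X s - w))
  calc _ = |f (rho X s) - f w - d * (rho X s - w) - (g (rho X s) - g w - e * (rho X s - w))| := by
        congr 1; ring
    _ ≤ _ := by linarith

lemma HasNablaDeriv.mul_const {f : ℝ → ℝ} {d s : ℝ} (hf : HasNablaDeriv X f d s) (c : ℝ) :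
    HasNablaDeriv X (fun t => f t * c) (d * c) s := by
  intro ε hε
  have hc : 0 < |c| + 1 := by positivity
  obtain ⟨δ, hδ, h⟩ := hf (ε / (|c| + 1)) (div_pos hε hc)
  refine ⟨δ, hδ, fun w hw hws => ?_⟩
  calc _ = |f (rho X s) - f w - d * (rho X s - w)| * |c| := by
        rw [← abs_mul]; congr 1; ring
    _ ≤ (ε / (|c| + 1) * |rho X s - w|) * (|c| + 1) :=
        mul_le_mul (h w hw hws) (by linarith) (abs_nonneg _) (by positivity)
    _ = ε * |rho X s - w| := by field_simp

lemma HasNablaDeriv.add {f g : ℝ → ℝ} {d e s : ℝ} (hf : HasNablaDeriv X f d s)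
    (hg : HasNablaDeriv X g e s) : HasNablaDeriv X (fun t => f t + g t) (d + e) s := by
  have := hf.sub ((hg.mul_const (-1)))
  simpa using this

lemma HasNablaDeriv.sum {ι : Type*} (S : Finset ι) {f : ι → ℝ → ℝ} {d : ι → ℝ} {s : ℝ}
    (hf : ∀ i ∈ S, HasNablaDeriv X (f i) (d i) s) :
    HasNablaDeriv X (fun t => ∑ i ∈ S, f i t) (∑ i ∈ S, d i) s := by
  classical
  induction S using Finset.induction_on with
  | empty => simpa using hasNablaDeriv_const X 0 s
  | insert i S hi ih =>
    simp only [Finset.sum_insert hi]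
    exact (hf i (Finset.mem_insert_self i S)).add
      (ih fun j hj => hf j (Finset.mem_insert_of_mem hj))

lemma HasMatrixNablaDeriv.mul_const {m n p : ℕ} {M : ℝ → Matrix (Fin m) (Fin n) ℝ}
    {D : Matrix (Fin m) (Fin n) ℝ} {s : ℝ} (hM : HasMatrixNablaDeriv X M D s)
    (N : Matrix (Fin n) (Fin p) ℝ) : HasMatrixNablaDeriv X (fun t => M t * N) (D * N) s := by
  intro i j
  simp only [Matrix.mul_apply]
  exact HasNablaDeriv.sum _ fun k _ => (hM i k).mul_const (N k j)

lemma HasMatrixNablaDeriv.sub {m n : ℕ} {M N : ℝ → Matrix (Fin m) (Fin n) ℝ}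
    {D E : Matrix (Fin m) (Fin n) ℝ} {s : ℝ} (hM : HasMatrixNablaDeriv X M D s)
    (hN : HasMatrixNablaDeriv X N E s) :
    HasMatrixNablaDeriv X (fun t => M t - N t) (D - E) s := fun i j =>
  (hM i j).sub (hN i j)

/-- The choice `w = s` is admissible for every `ε`, which forces the error to vanish. -/
lemma HasNablaDeriv.apply_rho {f : ℝ → ℝ} {d s : ℝ} (hf : HasNablaDeriv X f d s) (hs : s ∈ X) :
    f (rho X s) = f s + d * (rho X s - s) := by
  have h : |f (rho X s) - f s - d * (rho X s - s)| ≤ 0 := by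
    refine le_of_forall_pos_le_add fun η hη => ?_
    have hc : 0 < |rho X s - s| + 1 := by positivity
    obtain ⟨δ, hδ, h⟩ := hf (η / (|rho X s - s| + 1)) (div_pos hη hc)
    refine (h s hs (by simpa using hδ)).trans ?_
    rw [zero_add, div_mul_eq_mul_div, div_le_iff₀ hc]
    nlinarith
  linarith [abs_nonpos_iff.1 h]

lemma HasNablaDeriv.continuousWithinAt {f : ℝ → ℝ} {d s : ℝ} (hf : HasNablaDeriv X f d s)
    (hs : s ∈ X) : ContinuousWithinAt f X s := by
  have hlim : Tendsto (fun w => f (rho X s) - f w - d * (rho X s - w)) (𝓝[X] s) (𝓝 0) := by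
    rw [Metric.tendsto_nhdsWithin_nhds]
    intro η hη
    have hc : 0 < |rho X s - s| + 1 := by positivity
    obtain ⟨δ, hδ, h⟩ := hf (η / 2 / (|rho X s - s| + 1)) (by positivity)
    refine ⟨min δ 1, lt_min hδ one_pos, fun {w} hw hws => ?_⟩
    rw [Real.dist_eq] at hws ⊢
    rw [sub_zero]
    have h1 : |rho X s - w| ≤ |rho X s - s| + 1 := by
      have := abs_sub_le (rho X s) s w
      rw [abs_sub_comm s w] at this
      linarith [hws.trans_le (min_le_right δ 1)]
    calc _ ≤ η / 2 / (|rho X s - s| + 1) * |rho X s - w| :=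
          h w hw (hws.trans_le (min_le_left _ _))
      _ ≤ η / 2 / (|rho X s - s| + 1) * (|rho X s - s| + 1) := by gcongr
      _ = η / 2 := by field_simp
      _ < η := half_lt_self hη
  have hid : Tendsto (fun w : ℝ => f (rho X s) - d * (rho X s - w)) (𝓝[X] s)
      (𝓝 (f (rho X s) - d * (rho X s - s))) :=
    (Continuous.tendsto (by fun_prop) s).mono_left nhdsWithin_le_nhds
  have := hid.sub hlim
  rw [hf.apply_rho hs] at this
  have h2 : f s + d * (rho X s - s) - d * (rho X s - s) - 0 = f s := by ring
  rw [h2] at this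
  refine this.congr fun w => ?_
  rw [← hf.apply_rho hs]
  ring

lemma continuousOn_of_hasNablaDeriv {f d : ℝ → ℝ} (hf : ∀ s ∈ kappa X, HasNablaDeriv X f (d s) s) :
    ContinuousOn f X := by
  intro s hs
  by_cases hk : s ∈ kappa X
  · exact (hf s hk).continuousWithinAt hs
  · have hl : IsLeast X s ∧ s < sigma X s := by
      by_contra h
      exact hk ⟨hs, h⟩
    -- A point outside `kappa X` is a right-scattered minimum, hence isolated.
    refine tendsto_const_nhds.congr' ?_
    filter_upwards [self_mem_nhdsWithin, mem_nhdsWithin_of_mem_nhds (gt_mem_nhds hl.2)] with w hw hw'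
    rcases eq_or_lt_of_le (hl.1.2 hw) with rfl | h
    · rfl
    · exact absurd (sigma_le hw h) (not_le.2 hw')

lemma continuousOn_of_hasMatrixNablaDeriv {m n : ℕ} {M D : ℝ → Matrix (Fin m) (Fin n) ℝ}
    (hM : ∀ s ∈ kappa X, HasMatrixNablaDeriv X M (D s) s) : ContinuousOn M X :=
  continuousOn_pi.2 fun i => continuousOn_pi.2 fun j =>
    continuousOn_of_hasNablaDeriv fun s hs => hM s hs i j

/-- Gronwall estimate to the left of `b`. -/
lemma abs_le_mul_exp_of_hasMatrixNablaDeriv (hX : IsClosed X) {n p : ℕ}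
    {A : ℝ → Matrix (Fin n) (Fin n) ℝ} {Y : ℝ → Matrix (Fin n) (Fin p) ℝ} {a b K η : ℝ}
    (hb : b ∈ X) (hK : 0 ≤ K) (hη : 0 < η) (hA : ∀ t ∈ X, a ≤ t → t ≤ b → ∀ i j, |A t i j| ≤ K)
    (hY : ∀ s ∈ kappa X, HasMatrixNablaDeriv X Y (A s * Y s) s) (hYb : ∀ i j, |Y b i j| ≤ η) :
    ∀ s ∈ X, a ≤ s → s ≤ b → ∀ i j, |Y s i j| ≤ η * Real.exp ((n * K + 1) * (b - s)) := by
  have hbound : ∀ t ∈ X, a ≤ t → t ≤ b → ∀ β, 0 ≤ β → (∀ i j, |Y t i j| ≤ β) →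
      ∀ i j, |(A t * Y t) i j| ≤ n * K * β := by
    intro t ht hat htb β hβ h i j
    rw [Matrix.mul_apply]
    calc |∑ k, A t i k * Y t k j| ≤ ∑ k, |A t i k * Y t k j| := Finset.abs_sum_le_sum_abs _ _
      _ ≤ ∑ _k : Fin n, K * β := by
        refine Finset.sum_le_sum fun k _ => ?_
        rw [abs_mul]
        exact mul_le_mul (hA t ht hat htb i k) (h k j) (abs_nonneg _) hK
      _ = n * K * β := by simp [mul_assoc]
  -- From `1 + x ≤ exp x`: the bound survives a step from `s` to `w` that costs at most a factor `1
  -- + (n K + 1)(s - w)`.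
  have hexp : ∀ s w, η * Real.exp ((n * K + 1) * (b - s)) * (1 + (n * K + 1) * (s - w)) ≤
      η * Real.exp ((n * K + 1) * (b - w)) := by
    intro s w
    have h1 : Real.exp ((n * K + 1) * (b - w)) =
        Real.exp ((n * K + 1) * (b - s)) * Real.exp ((n * K + 1) * (s - w)) := by
      rw [← Real.exp_add]; congr 1; ring
    rw [h1, ← mul_assoc]
    have := Real.add_one_le_exp ((n * K + 1) * (s - w))
    exact mul_le_mul_of_nonneg_left (by linarith) (by positivity)
  have hcont := continuousOn_of_hasMatrixNablaDeriv hY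
  intro s hs has hsb
  refine backward_induction hX
    (fun s => ∀ i j, |Y s i j| ≤ η * Real.exp ((n * K + 1) * (b - s)))
    (by simpa using hYb) a ?_ ?_ ?_ s hs has hsb hb
  · intro s hs has hsb hρ h i j
    set β := η * Real.exp ((n * K + 1) * (b - s)) with hβ
    have hβ0 : 0 ≤ β := by positivity
    have hd := hY s (mem_kappa_of_nonempty hs (nonempty_of_rho_lt hρ)) i j
    rw [hd.apply_rho hs]
    refine le_trans ?_ (hexp s (rho X s))
    have h1 := hbound s hs has hsb β hβ0 h i j
    have h2 : |(A s * Y s) i j * (rho X s - s)| ≤ n * K * β * (s - rho X s) := by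
      rw [abs_mul, abs_of_neg (sub_neg.2 hρ), neg_sub]
      exact mul_le_mul_of_nonneg_right h1 (sub_nonneg.2 hρ.le)
    have h3 := abs_add_le (Y s i j) ((A s * Y s) i j * (rho X s - s))
    have h4 : 0 ≤ β * (s - rho X s) := mul_nonneg hβ0 (sub_nonneg.2 hρ.le)
    rw [← hβ]
    linarith [h i j]
  · intro s hs has hsb hne hρ h
    set β := η * Real.exp ((n * K + 1) * (b - s)) with hβ
    have hβ0 : 0 < β := by positivity
    simp only [eventually_all]
    intro i j
    -- With `ε = β` the differentiation error is at most `β (s - w)`, which the extra `1` in the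
    -- rate `n K + 1` absorbs.
    obtain ⟨δ, hδ, hd⟩ := hY s (mem_kappa_of_nonempty hs hne) i j β hβ0
    filter_upwards [self_mem_nhdsWithin, mem_nhdsWithin_of_mem_nhds (Metric.ball_mem_nhds s hδ)]
      with w hw hwδ
    have hws : w < s := hw.2
    have h0 := hd w hw.1 (by simpa [Real.dist_eq] using hwδ)
    rw [hρ, abs_of_pos (sub_pos.2 hws)] at h0
    refine le_trans ?_ (hexp s w)
    have h1 := hbound s hs has hsb β hβ0.le h i j
    have h2 : |(A s * Y s) i j * (s - w)| ≤ n * K * β * (s - w) := by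
      rw [abs_mul, abs_of_pos (sub_pos.2 hws)]
      exact mul_le_mul_of_nonneg_right h1 (sub_nonneg.2 hws.le)
    have h3 := h i j
    rw [← hβ]
    rw [abs_le] at h0 h2 h3 ⊢
    constructor <;> linarith [h0.1, h0.2, h2.1, h2.2, h3.1, h3.2]
  · intro s hs _ hsb hcl h i j
    have := mem_closure_iff_nhdsWithin_neBot.1 hcl
    have hY' : Tendsto (fun t => |Y t i j|) (𝓝[X ∩ Ioi s] s) (𝓝 |Y s i j|) := by
      have h1 : ContinuousWithinAt (fun t => Y t i j) X s :=
        continuousWithinAt_pi.1 (continuousWithinAt_pi.1 (hcont s hs) i) j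
      exact (h1.mono_left (nhdsWithin_mono _ inter_subset_left)).abs
    have hE : Tendsto (fun t => η * Real.exp ((n * K + 1) * (b - t))) (𝓝[X ∩ Ioi s] s)
        (𝓝 (η * Real.exp ((n * K + 1) * (b - s)))) :=
      (Continuous.tendsto (by fun_prop) s).mono_left nhdsWithin_le_nhds
    refine le_of_tendsto_of_tendsto hY' hE ?_
    filter_upwards [self_mem_nhdsWithin, mem_nhdsWithin_of_mem_nhds (gt_mem_nhds hsb)] with t ht htb
    exact h t ht.1 ht.2 htb.le i j

/-- A solution of `Y^∇ = A Y` that vanishes at `b` vanishes to the left of `b`. -/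
lemma eq_zero_of_hasMatrixNablaDeriv (hX : IsClosed X) {n p : ℕ}
    {A : ℝ → Matrix (Fin n) (Fin n) ℝ} (hA : LdContinuous X A) {Y : ℝ → Matrix (Fin n) (Fin p) ℝ}
    (hY : ∀ s ∈ kappa X, HasMatrixNablaDeriv X Y (A s * Y s) s) {b : ℝ} (hb : b ∈ X)
    (hYb : Y b = 0) {s : ℝ} (hs : s ∈ X) (hsb : s ≤ b) : Y s = 0 := by
  obtain ⟨K, hK0, hK⟩ := hA.exists_matrix_bound
    (isCompact_Icc.inter_left hX : IsCompact (X ∩ Icc s b)) inter_subset_left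
  ext i j
  have key : ∀ η > 0, |Y s i j| ≤ η := by
    intro η hη
    -- The initial bound is scaled so that the exponential cancels at `s`.
    have := abs_le_mul_exp_of_hasMatrixNablaDeriv hX (a := s)
      (η := η / Real.exp ((n * K + 1) * (b - s))) hb hK0 (by positivity)
      (fun t ht hst htb => hK t ⟨ht, hst, htb⟩) hY
      (fun i j => by rw [hYb, Matrix.zero_apply, abs_zero]; positivity) s hs le_rfl hsb i j
    rwa [div_mul_cancel₀ _ (Real.exp_pos _).ne'] at this
  have : |Y s i j| ≤ 0 := le_of_forall_pos_le_add fun η hη => by simpa using key η hη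
  simpa using this

end NablaDeriv

/-! ### Splitting the transition function; realizations and factorizations -/

section Realization

variable {X : Set ℝ} {n : ℕ} {A : ℝ → Matrix (Fin n) (Fin n) ℝ}
  {Ψ : ℝ → ℝ → Matrix (Fin n) (Fin n) ℝ}

lemma IsTransition.eq_mul (hX : IsClosed X) (hA : LdContinuous X A) (hΨ : IsTransition X A Ψ)
    {b : ℝ} (hb : IsGreatest X b) {s w : ℝ} (hs : s ∈ X) (hw : w ∈ X) :
    Ψ s w = Ψ s b * Ψ b w := by
  refine sub_eq_zero.1 (eq_zero_of_hasMatrixNablaDeriv hX hA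
    (Y := fun t => Ψ t w - Ψ t b * Ψ b w) (fun t ht => ?_) hb.1 ?_ hs (hb.2 hs))
  · have := ((hΨ w hw).2 t ht).sub (((hΨ b hb.1).2 t ht).mul_const (Ψ b w))
    rwa [Matrix.mul_assoc, ← Matrix.mul_sub] at this
  · simp [(hΨ b hb.1).1]

lemma IsTransition.continuousOn (hΨ : IsTransition X A Ψ) {w : ℝ} (hw : w ∈ X) :
    ContinuousOn (fun t => Ψ t w) X :=
  continuousOn_of_hasMatrixNablaDeriv (hΨ w hw).2

/-- The definition of `Ψ` says nothing on regularity in the second variable. Splitting `Ψ w w = 1`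
through `b` makes `Ψ b w` the inverse of `Ψ w b`, and the adjugate formula transfers continuity. -/
lemma IsTransition.continuousOn_right (hX : IsClosed X) (hA : LdContinuous X A)
    (hΨ : IsTransition X A Ψ) {b : ℝ} (hb : IsGreatest X b) :
    ContinuousOn (fun w => Ψ b w) X := by
  have hinv : ∀ w ∈ X, Ψ w b * Ψ b w = 1 := fun w hw => by
    rw [← hΨ.eq_mul hX hA hb hw hw, (hΨ w hw).1]
  have hc := hΨ.continuousOn hb.1
  have hdet : ContinuousOn (fun w => (Ψ w b).det) X :=
    (continuous_id.matrix_det).comp_continuousOn hc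
  have hadj : ContinuousOn (fun w => (Ψ w b).adjugate) X :=
    (continuous_id.matrix_adjugate).comp_continuousOn hc
  have hne : ∀ w ∈ X, (Ψ w b).det ≠ 0 := fun w hw h => by
    have := congrArg Matrix.det (hinv w hw)
    rw [Matrix.det_mul, h, zero_mul, Matrix.det_one] at this
    exact zero_ne_one this
  refine ((hdet.inv₀ hne).smul hadj).congr fun w hw => ?_
  rw [← Matrix.inv_eq_right_inv (hinv w hw), Matrix.inv_def, Ring.inverse_eq_inv']
  rfl

lemma IsRealizableOfDim.factors (hX : IsClosed X) {b : ℝ} (hb : IsGreatest X b) {q r : ℕ}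
    {G : ℝ → ℝ → Matrix (Fin q) (Fin r) ℝ} (hG : IsRealizableOfDim X n G) : Factors X n G := by
  obtain ⟨Λ, Ψ, hΨ, hG⟩ := hG
  refine ⟨fun s => Λ.C s * Ψ s b, fun z => Ψ b (rho X z) * Λ.B z,
    Λ.ld_C.matrix_mul (.of_continuousOn (hΨ.continuousOn hb.1)),
    (LdContinuous.comp_rho hX (hΨ.continuousOn_right hX Λ.ld_A hb)).matrix_mul Λ.ld_B,
    fun s hs z hz => ?_⟩
  rw [hG s hs z hz, hΨ.eq_mul hX Λ.ld_A hb hs (rho_mem hX hz)]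
  simp only [Matrix.mul_assoc]

lemma isTransition_one (X : Set ℝ) (n : ℕ) :
    IsTransition X (fun _ => (0 : Matrix (Fin n) (Fin n) ℝ)) fun _ _ => 1 := fun w _ =>
  ⟨rfl, fun s _ i j => by simpa using hasNablaDeriv_const X ((1 : Matrix (Fin n) (Fin n) ℝ) i j) s⟩

lemma Factors.isRealizableOfDim {q r : ℕ} {G : ℝ → ℝ → Matrix (Fin q) (Fin r) ℝ}
    (hG : Factors X n G) : IsRealizableOfDim X n G := by
  obtain ⟨H, F, hH, hF, hG⟩ := hG
  refine ⟨⟨fun _ => 0, F, H, .of_continuousOn continuousOn_const, hF, hH⟩, fun _ _ => 1,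
    isTransition_one X n, fun s hs z hz => ?_⟩
  rw [hG s hs z hz, Matrix.mul_one]

end Realization

end TimeScale

theorem theorem6p1 (T : Set ℝ) (hT : TimeScale.IsTimeScale T) (s₀ : ℝ) (hs₀ : s₀ ∈ T)
    (q r : ℕ) (G : ℝ → ℝ → Matrix (Fin q) (Fin r) ℝ) :
    (TimeScale.IsRealizable (TimeScale.leftRay T s₀) G ↔
      ∀ s₁ ∈ T, s₁ ≤ s₀ → ∃ n : ℕ, TimeScale.Factors (TimeScale.leftRay T s₁) n G) ∧
    ∀ n : ℕ, TimeScale.IsRealizableOfDim (TimeScale.leftRay T s₀) n G ↔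
      ∀ s₁ ∈ T, s₁ ≤ s₀ → TimeScale.Factors (TimeScale.leftRay T s₁) n G := by
  have hX : IsClosed (TimeScale.leftRay T s₀) := hT.2.inter isClosed_Iic
  have hb : IsGreatest (TimeScale.leftRay T s₀) s₀ := ⟨⟨hs₀, le_refl s₀⟩, fun _ ht => ht.2⟩
  refine ⟨⟨?_, fun h => ?_⟩, fun n => ⟨fun h s₁ hs₁ hle => ?_, fun h => ?_⟩⟩
  · rintro ⟨n, h⟩ s₁ hs₁ hle
    exact ⟨n, (h.factors hX hb).mono_leftRay hs₁ hle⟩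
  · obtain ⟨n, hn⟩ := h s₀ hs₀ le_rfl
    exact ⟨n, hn.isRealizableOfDim⟩
  · exact (h.factors hX hb).mono_leftRay hs₁ hle
  · exact (h s₀ hs₀ le_rfl).isRealizableOfDim
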